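/- Let $n\ge 2$ be a natural number and let $$\mathcal M=\{A\in\mathbb R^{n\times n} : A=A^T,\ A_{ii}=0 \text{ and } A_{ij}\ge 0 \text{ for all } i,j=1,\dots,n\}$$ be the set of weighted adjacency matrices, on which the symmetric group $S_n$ acts by conjugation, $P_*A=PAP^T$ for a permutation matrix $P$. Let $1_n$ be the all-ones vector, let $\mathrm{sort}$ denote sorting in ascending order (with multiplicity), and define on $\mathcal M$ $$F(A)=\bigl(\mathrm{sort}(A1_n),\ \mathrm{sort}\{A_{ij} : 1\le i<j\le n\}\bigr).$$ Then $F$ is invariant under the action of $S_n$, i.e. $F(PAP^T)=F(A)$ for all $A\in\mathcal M$ and all permutation matrices $P$, and $F$ is generically separating on $\mathcal M$: the set $\mathcal M$ is semi-algebraic, and there is a semi-algebraic set $\mathcal N\subseteq\mathcal M$, stable under the action of $S_n$, with $\dim\mathcal N<\dim\mathcal M$, such that for every $A\in\mathcal M\setminus\mathcal N$ and every $B\in\mathcal M$ with $F(A)=F(B)$ there is a permutation matrix $P$ with $B=PAP^T$. Here a semi-algebraic set in $\mathbb R^k$ is a finite union of sets, each defined by finitely many polynomial equations $p=0$ and strict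 inequalities $q>0$ with real coefficients. Its dimension is the maximal dimension of a stratum in a stratification, that is, in a partition into finitely many nonempty semi-algebraic $C^\infty$ submanifolds of $\mathbb R^k$ such that the closure of each stratum in the set is the union of that stratum and of some strata of smaller dimension (this does not depend on the stratification; $\dim\emptyset=-\infty$). -/

import Mathlib

open scoped ContDiff

namespace GenericGraph

section RealAlgebraicGeometry

variable {ι : Type*} [Fintype ι]

/-- A real semi-algebraic set in `ℝ^ι`: a finite union of sets, each cut out by finitely many
polynomial equations `p = 0` and finitely many strict polynomial inequalities `q > 0`. -/
def IsSemialgebraic (S : Set (ι → ℝ)) : Prop :=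
  ∃ F : Finset (Finset (MvPolynomial ι ℝ) × Finset (MvPolynomial ι ℝ)),
    S = {x | ∃ c ∈ F, (∀ p ∈ c.1, MvPolynomial.eval x p = 0) ∧
      ∀ q ∈ c.2, 0 < MvPolynomial.eval x q}

/-- `S` is an embedded `C^∞` submanifold of `ℝ^ι` of dimension `r`: around each of its points there
is a `C^∞` diffeomorphism between open subsets of `ℝ^ι` that carries `S` to an `r`-dimensional
linear subspace. -/
def IsSmoothSubmanifold (r : ℕ) (S : Set (ι → ℝ)) : Prop :=
  ∀ x ∈ S, ∃ (W : Submodule ℝ (ι → ℝ)) (e : OpenPartialHomeomorph (ι → ℝ) (ι → ℝ)),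
    Module.finrank ℝ W = r ∧ x ∈ e.source ∧
    ContDiffOn ℝ ∞ e e.source ∧ ContDiffOn ℝ ∞ e.symm e.target ∧
    ∀ y ∈ e.source, (y ∈ S ↔ e y ∈ W)

/-- A stratification of `S`: a finite partition of `S` into nonempty semi-algebraic sets `T i`, each
a `C^∞` manifold of dimension `r i`, such that the closure of `T i` in `S` is the union of `T i` and
of some of the `T j` with `r j < r i`. -/
structure IsStratification (S : Set (ι → ℝ)) {m : ℕ} (T : Fin m → Set (ι → ℝ))
    (r : Fin m → ℕ) : Prop where
  iUnion_eq : ⋃ i, T i = S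
  disjoint : Pairwise fun i j => Disjoint (T i) (T j)
  nonempty : ∀ i, (T i).Nonempty
  semialgebraic : ∀ i, IsSemialgebraic (T i)
  manifold : ∀ i, IsSmoothSubmanifold (r i) (T i)
  frontier : ∀ i j, i ≠ j → (closure (T i) ∩ T j).Nonempty →
    T j ⊆ closure (T i) ∧ r j < r i

/-- The dimension of a semi-algebraic set: the maximal dimension of a stratum in a stratification.
This number does not depend on the stratification, so the supremum over all stratifications is
their common value. The empty set has dimension `⊥`. -/
noncomputable def dim (S : Set (ι → ℝ)) : WithBot ℕ∞ :=
  ⨆ (m : ℕ) (T : Fin m → Set (ι → ℝ)) (r : Fin m → ℕ) (_ : IsStratification S T r) (i : Fin m),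
    ((r i : ℕ∞) : WithBot ℕ∞)

/-- Let the group `G` act on the semi-algebraic set `M ⊆ ℝ^ι`. The `G`-invariant function `f` on `M`
is generically separating with singular set `N`. -/
structure IsGenericallySeparating (G : Type*) [Group G] (M : Set (ι → ℝ)) [MulAction G M]
    {Y : Type*} (f : M → Y) (N : Set (ι → ℝ)) : Prop where
  semialgebraic_domain : IsSemialgebraic M
  invariant : ∀ (g : G) (x : M), f (g • x) = f x
  subset : N ⊆ M
  semialgebraic : IsSemialgebraic N
  stable : ∀ (g : G) (x : M), (x : ι → ℝ) ∈ N → ((g • x : M) : ι → ℝ) ∈ N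
  dim_lt : dim N < dim M
  separating : ∀ x : M, (x : ι → ℝ) ∉ N → ∀ y : M, f x = f y → y ∈ MulAction.orbit G x

end RealAlgebraicGeometry

section Sorting

variable {ι : Type*} [Fintype ι]

/-- The entries of a finite family of reals, with multiplicity, sorted in ascending order. -/
noncomputable def sort (x : ι → ℝ) : List.Vector ℝ (Fintype.card ι) :=
  ⟨(Finset.univ.val.map x).sort (· ≤ ·), by simp⟩

end Sorting

section Graphs

variable {n : ℕ}

/-- The `n × n` matrix with the given coordinates. -/
def toMatrix (x : Fin n × Fin n → ℝ) : Matrix (Fin n) (Fin n) ℝ :=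
  Matrix.of fun i j => x (i, j)

/-- The coordinates of an `n × n` matrix. -/
def coords (A : Matrix (Fin n) (Fin n) ℝ) : Fin n × Fin n → ℝ :=
  fun p => A p.1 p.2

/-- The symmetric `n × n` matrices with zero diagonal and nonnegative entries, as a subset of
`ℝ^(n × n)`. -/
def weightedAdjacency (n : ℕ) : Set (Fin n × Fin n → ℝ) :=
  {x | toMatrix x = (toMatrix x).transpose ∧ (∀ i, toMatrix x i i = 0) ∧
    ∀ i j, 0 ≤ toMatrix x i j}

/-- The permutation matrix `P` of `σ`, with `P e_j = e_{σ j}`. -/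
def permMat (σ : Equiv.Perm (Fin n)) : Matrix (Fin n) (Fin n) ℝ :=
  Matrix.of fun i j => if i = σ j then 1 else 0

theorem conj_apply (σ : Equiv.Perm (Fin n)) (A : Matrix (Fin n) (Fin n) ℝ) (i j : Fin n) :
    (permMat σ * A * (permMat σ).transpose) i j = A (σ⁻¹ i) (σ⁻¹ j) := by
  have h : ∀ a b : Fin n, (a = σ b) ↔ (σ⁻¹ a = b) := fun a b => by
    rw [Equiv.Perm.inv_eq_iff_eq]
  simp [permMat, Matrix.mul_apply, h]

/-- The action of the symmetric group by conjugation, `A ↦ P A Pᵀ`. -/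
instance : MulAction (Equiv.Perm (Fin n)) (weightedAdjacency n) where
  smul σ x := ⟨coords (permMat σ * toMatrix x.1 * (permMat σ).transpose), by
    obtain ⟨h1, h2, h3⟩ := x.2
    have key : toMatrix (coords (permMat σ * toMatrix x.1 * (permMat σ).transpose))
        = permMat σ * toMatrix x.1 * (permMat σ).transpose := rfl
    refine ⟨?_, fun i => ?_, fun i j => ?_⟩
    · ext i j
      rw [key, Matrix.transpose_apply, conj_apply, conj_apply]
      exact congrFun (congrFun h1 _) _
    · rw [key, conj_apply]; exact h2 _
    · rw [key, conj_apply]; exact h3 _ _⟩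
  one_smul x := by
    apply Subtype.ext
    funext p
    exact (conj_apply 1 (toMatrix x.1) p.1 p.2).trans rfl
  mul_smul σ τ x := by
    apply Subtype.ext
    funext p
    refine (conj_apply (σ * τ) (toMatrix x.1) p.1 p.2).trans
      (Eq.trans ?_ (conj_apply σ (permMat τ * toMatrix x.1 * (permMat τ).transpose) p.1 p.2).symm)
    rw [conj_apply, mul_inv_rev]
    rfl

/-- The map `F(A) = (sort (A 1_n), sort {A_ij, i < j})`. -/
noncomputable def graphInvariant (A : Matrix (Fin n) (Fin n) ℝ) :
    List.Vector ℝ (Fintype.card (Fin n)) ×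
      List.Vector ℝ (Fintype.card {p : Fin n × Fin n // p.1 < p.2}) :=
  (sort (A.mulVec 1), sort fun p : {p : Fin n × Fin n // p.1 < p.2} => A p.1.1 p.1.2)

end Graphs

end GenericGraph

/-! The singular set consists of the matrices for which two different edge sets have equal total
weight. Let A lie outside it and F(A) = F(B). Equality of the sorted lists gives a vertex
permutation σ matching row sums and an edge permutation π matching weights. A row sum is the total
weight of the star of a vertex, so π(star i) and star(σ i) have the same A-weight and must coincide.
Two distinct stars share only the edge joining their centres, so π sends {i, j} to {σ i, σ j}, and B
is A relabelled (`mem_orbit_of_graphInvariant_eq`).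

For the dimensions, the singular set is covered by finitely many proper subspaces of the hollow
symmetric matrices. Baire's theorem then bounds every manifold inside it, whatever the
stratification (`dim_le_of_covered`). From below, one stratification of the cone suffices: its
faces, indexed by the set of edges of positive weight (`isStratification_face`). -/

namespace GenericGraph

/-! ### Closure properties of semi-algebraic sets -/

section Semialgebraic

variable {ι : Type*}

theorem IsSemialgebraic.of_basic (P Q : Finset (MvPolynomial ι ℝ)) :
    IsSemialgebraic {x : ι → ℝ | (∀ p ∈ P, MvPolynomial.eval x p = 0) ∧
      ∀ q ∈ Q, 0 < MvPolynomial.eval x q} :=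
  ⟨{(P, Q)}, by simp⟩

theorem IsSemialgebraic.eq_zero (p : MvPolynomial ι ℝ) :
    IsSemialgebraic {x : ι → ℝ | MvPolynomial.eval x p = 0} := by
  simpa using IsSemialgebraic.of_basic {p} ∅

theorem IsSemialgebraic.pos (p : MvPolynomial ι ℝ) :
    IsSemialgebraic {x : ι → ℝ | 0 < MvPolynomial.eval x p} := by
  simpa using IsSemialgebraic.of_basic ∅ {p}

theorem IsSemialgebraic.univ : IsSemialgebraic (Set.univ : Set (ι → ℝ)) := by
  simpa using IsSemialgebraic.of_basic (ι := ι) ∅ ∅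

theorem IsSemialgebraic.empty : IsSemialgebraic (∅ : Set (ι → ℝ)) :=
  ⟨∅, by simp⟩

theorem IsSemialgebraic.union {S T : Set (ι → ℝ)} (hS : IsSemialgebraic S)
    (hT : IsSemialgebraic T) : IsSemialgebraic (S ∪ T) := by
  classical
  obtain ⟨F, rfl⟩ := hS
  obtain ⟨G, rfl⟩ := hT
  refine ⟨F ∪ G, ?_⟩
  ext x
  simp only [Set.mem_union, Set.mem_ofPred_eq, Finset.mem_union, or_and_right, exists_or]

theorem IsSemialgebraic.inter {S T : Set (ι → ℝ)} (hS : IsSemialgebraic S)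
    (hT : IsSemialgebraic T) : IsSemialgebraic (S ∩ T) := by
  classical
  obtain ⟨F, rfl⟩ := hS
  obtain ⟨G, rfl⟩ := hT
  refine ⟨(F ×ˢ G).image fun c => (c.1.1 ∪ c.2.1, c.1.2 ∪ c.2.2), ?_⟩
  ext x
  simp only [Set.mem_inter_iff, Set.mem_ofPred_eq, Finset.mem_image, Finset.mem_product]
  constructor
  · rintro ⟨⟨c, hc, h1, h2⟩, d, hd, h3, h4⟩
    refine ⟨_, ⟨(c, d), ⟨hc, hd⟩, rfl⟩, ?_, ?_⟩
    · intro p hp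
      exact (Finset.mem_union.1 hp).elim (h1 p) (h3 p)
    · intro p hp
      exact (Finset.mem_union.1 hp).elim (h2 p) (h4 p)
  · rintro ⟨_, ⟨⟨c, d⟩, ⟨hc, hd⟩, rfl⟩, h1, h2⟩
    exact ⟨⟨c, hc, fun p hp => h1 p (Finset.mem_union_left _ hp),
      fun p hp => h2 p (Finset.mem_union_left _ hp)⟩,
      d, hd, fun p hp => h1 p (Finset.mem_union_right _ hp),
      fun p hp => h2 p (Finset.mem_union_right _ hp)⟩

theorem IsSemialgebraic.iUnion {κ : Type*} [Finite κ] {S : κ → Set (ι → ℝ)}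
    (hS : ∀ k, IsSemialgebraic (S k)) : IsSemialgebraic (⋃ k, S k) := by
  classical
  cases nonempty_fintype κ
  have h : ∀ F : Finset κ, IsSemialgebraic (⋃ k ∈ F, S k) := fun F => by
    induction F using Finset.induction_on with
    | empty => simpa using IsSemialgebraic.empty
    | insert a F _ ih => rw [Finset.set_biUnion_insert]; exact (hS a).union ih
  simpa using h Finset.univ

theorem IsSemialgebraic.iInter {κ : Type*} [Finite κ] {S : κ → Set (ι → ℝ)}
    (hS : ∀ k, IsSemialgebraic (S k)) : IsSemialgebraic (⋂ k, S k) := by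
  classical
  cases nonempty_fintype κ
  have h : ∀ F : Finset κ, IsSemialgebraic (⋂ k ∈ F, S k) := fun F => by
    induction F using Finset.induction_on with
    | empty => simpa using IsSemialgebraic.univ
    | insert a F _ ih => rw [Finset.set_biInter_insert]; exact (hS a).inter ih
  simpa using h Finset.univ

theorem IsSemialgebraic.nonneg (p : MvPolynomial ι ℝ) :
    IsSemialgebraic {x : ι → ℝ | 0 ≤ MvPolynomial.eval x p} := by
  convert (IsSemialgebraic.pos p).union (IsSemialgebraic.eq_zero p) using 1
  ext x
  simp only [Set.mem_ofPred_eq, Set.mem_union, le_iff_lt_or_eq, eq_comm]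

end Semialgebraic

/-! ### Bounds on dimension -/

section Dimension

variable {ι : Type*} [Fintype ι]

/-- Difference quotients of `g` along `W` lie in the closed subspace `H`, so the derivative `A` maps
`W` into `H`; its left inverse `B` makes it injective. -/
theorem finrank_le_of_eventually_mem {V : Type*} [NormedAddCommGroup V] [NormedSpace ℝ V]
    [FiniteDimensional ℝ V] (W H : Submodule ℝ V) (g : V → V) (A B : V →L[ℝ] V) (w : V)
    (hg : HasFDerivAt g A w) (hBA : B.comp A = ContinuousLinearMap.id ℝ V)
    (hH : ∀ v ∈ W, ∀ᶠ t : ℝ in nhds 0, g (w + t • v) ∈ H) :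
    Module.finrank ℝ W ≤ Module.finrank ℝ H := by
  have hA : ∀ v ∈ W, A v ∈ H := fun v hv => by
    have hline : HasDerivAt (fun t : ℝ => w + t • v) v 0 := by
      simpa using ((hasDerivAt_id (0 : ℝ)).smul_const v).const_add w
    have hder : HasDerivAt (fun t : ℝ => g (w + t • v)) (A v) 0 := by
      have h0 : HasFDerivAt g A (w + (0 : ℝ) • v) := by simpa using hg
      exact h0.comp_hasDerivAt (0 : ℝ) hline
    have hlim := hder.tendsto_slope_zero
    refine (Submodule.closed_of_finiteDimensional H).mem_of_tendsto hlim ?_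
    filter_upwards [(hH v hv).filter_mono nhdsWithin_le_nhds] with t ht
    rw [zero_add]
    exact H.smul_mem _ (H.sub_mem ht (hH v hv).self_of_nhds)
  have hinj : Function.Injective A := fun u v h => by
    have := congrArg B h
    simpa [← ContinuousLinearMap.comp_apply, hBA] using this
  refine LinearMap.finrank_le_finrank_of_injective
    (f := (A : V →ₗ[ℝ] V).restrict (p := W) (q := H) hA) ?_
  intro u v h
  exact Subtype.ext (hinj (congrArg Subtype.val h))

/-- A nonempty manifold that is covered by finitely many linear subspaces has at most the dimension
of one of them. -/
theorem IsSmoothSubmanifold.exists_le_finrank {r : ℕ} {S : Set (ι → ℝ)}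
    (hS : IsSmoothSubmanifold r S) (hne : S.Nonempty) {κ : Type*} [Finite κ]
    (H : κ → Submodule ℝ (ι → ℝ)) (hH : ∀ x ∈ S, ∃ k, x ∈ H k) :
    ∃ k, r ≤ Module.finrank ℝ (H k) := by
  obtain ⟨x, hx⟩ := hne
  obtain ⟨k₀, -⟩ := hH x hx
  obtain ⟨W, e, rfl, hxe, he, he', hW⟩ := hS x hx
  -- Outside the chart's target the condition is vacuous. This makes each `C k` closed in all of `W`
  -- and lets the `C k` cover `W`, so Baire's theorem applies there.
  let C : κ → Set W := fun k => {w | (w : ι → ℝ) ∈ e.target → e.symm w ∈ H k}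
  have hO : IsOpen {w : W | (w : ι → ℝ) ∈ e.target} :=
    e.open_target.preimage continuous_subtype_val
  have hC : ∀ k, IsClosed (C k) := fun k => by
    have h1 := e.continuousOn_symm.isOpen_inter_preimage e.open_target
      (Submodule.closed_of_finiteDimensional (H k)).isOpen_compl
    refine ⟨?_⟩
    convert h1.preimage (continuous_subtype_val (p := fun w => w ∈ W)) using 1
    ext w
    simp [C]
  have hU : ⋃ k, C k = Set.univ := by
    refine Set.eq_univ_of_forall fun w => Set.mem_iUnion.2 ?_
    by_cases hw : (w : ι → ℝ) ∈ e.target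
    · have hmem : e.symm w ∈ S := (hW _ (e.map_target hw)).2 (by
        rw [e.right_inv hw]; exact w.2)
      obtain ⟨k, hk⟩ := hH _ hmem
      exact ⟨k, fun _ => hk⟩
    · exact ⟨k₀, fun h => absurd h hw⟩
  obtain ⟨w, hw, hwC⟩ := (dense_iUnion_interior_of_closed hC hU).inter_open_nonempty _ hO
    ⟨⟨e x, (hW x hxe).1 hx⟩, e.map_source hxe⟩
  obtain ⟨k, hk⟩ := Set.mem_iUnion.1 hwC
  have hw : (w : ι → ℝ) ∈ e.target := hw
  have hd' : HasFDerivAt e.symm (fderiv ℝ e.symm w) (w : ι → ℝ) :=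
    ((he'.differentiableOn (by simp)).differentiableAt (e.open_target.mem_nhds hw)).hasFDerivAt
  have hd : HasFDerivAt e (fderiv ℝ e (e.symm w)) (e.symm w) :=
    ((he.differentiableOn (by simp)).differentiableAt
      (e.open_source.mem_nhds (e.map_target hw))).hasFDerivAt
  -- Differentiating `e ∘ e.symm = id` near `w` shows that the derivative of `e` is the required
  -- left inverse.
  refine ⟨k, finrank_le_of_eventually_mem W (H k) e.symm _ (fderiv ℝ e (e.symm w)) w hd' ?_ ?_⟩
  · refine (hd.comp (w : ι → ℝ) hd').unique ((hasFDerivAt_id _).congr_of_eventuallyEq ?_)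
    filter_upwards [e.open_target.mem_nhds hw] with y hy using e.right_inv hy
  · intro v hv
    have hc : Filter.Tendsto (fun t : ℝ => w + t • (⟨v, hv⟩ : W)) (nhds 0) (nhds w) := by
      have : Continuous fun t : ℝ => w + t • (⟨v, hv⟩ : W) := by fun_prop
      simpa using this.tendsto 0
    have h1 := hc.eventually (isOpen_interior.mem_nhds hk)
    have h2 := hc.eventually (hO.mem_nhds hw)
    filter_upwards [h1, h2] with t ht1 ht2
    exact interior_subset ht1 ht2

theorem dim_le_of_covered {S : Set (ι → ℝ)} {κ : Type*} [Finite κ]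
    (H : κ → Submodule ℝ (ι → ℝ)) (hH : ∀ x ∈ S, ∃ k, x ∈ H k) {d : ℕ}
    (hd : ∀ k, Module.finrank ℝ (H k) ≤ d) : dim S ≤ ((d : ℕ∞) : WithBot ℕ∞) := by
  refine iSup_le fun m => iSup_le fun T => iSup_le fun r => iSup_le fun h => iSup_le fun i => ?_
  obtain ⟨k, hk⟩ := (h.manifold i).exists_le_finrank (h.nonempty i) H
    fun x hx => hH x (h.iUnion_eq ▸ Set.mem_iUnion.2 ⟨i, hx⟩)
  exact_mod_cast hk.trans (hd k)

theorem IsStratification.le_dim {S : Set (ι → ℝ)} {m : ℕ} {T : Fin m → Set (ι → ℝ)}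
    {r : Fin m → ℕ} (h : IsStratification S T r) (i : Fin m) :
    ((r i : ℕ∞) : WithBot ℕ∞) ≤ dim S :=
  le_iSup_of_le m <| le_iSup_of_le T <| le_iSup_of_le r <| le_iSup_of_le h <|
    le_iSup (fun i => ((r i : ℕ∞) : WithBot ℕ∞)) i

theorem IsSmoothSubmanifold.of_isOpen_inter (W : Submodule ℝ (ι → ℝ)) {O S : Set (ι → ℝ)}
    (hO : IsOpen O) (hSO : S ⊆ O) (h : ∀ y ∈ O, (y ∈ S ↔ y ∈ W)) :
    IsSmoothSubmanifold (Module.finrank ℝ W) S := fun _ hx =>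
  ⟨W, OpenPartialHomeomorph.ofSet O hO, rfl, hSO hx, contDiffOn_id, contDiffOn_id, h⟩

end Dimension

end GenericGraph

namespace GenericGraph

/-! ### Equality of sorted lists -/

section Sorting

/-- Equal multiplicities mean that the fibres of `f` and `g` over each value are equinumerous;
bijections between the fibres glue to a permutation. -/
theorem exists_perm_of_map_univ_eq {ι β : Type*} [Fintype ι] {f g : ι → β}
    (h : Finset.univ.val.map f = Finset.univ.val.map g) :
    ∃ σ : Equiv.Perm ι, ∀ i, g (σ i) = f i := by
  classical
  have key : ∀ c, Nonempty ({i // f i = c} ≃ {i // g i = c}) := fun c => by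
    have hc := congrArg (Multiset.count c) h
    rw [Multiset.count_map, Multiset.count_map] at hc
    refine ⟨Fintype.equivOfCardEq ?_⟩
    rw [Fintype.card_subtype, Fintype.card_subtype]
    simp only [eq_comm (b := c)]
    exact hc
  exact ⟨Equiv.ofFiberEquiv fun c => (key c).some, fun i => Equiv.ofFiberEquiv_map _ i⟩

theorem sort_eq_sort_iff {ι : Type*} [Fintype ι] {f g : ι → ℝ} :
    sort f = sort g ↔ ∃ σ : Equiv.Perm ι, ∀ i, g (σ i) = f i := by
  constructor
  · intro h
    have h1 := congrArg Subtype.val h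
    refine exists_perm_of_map_univ_eq ?_
    rw [← Multiset.sort_eq (Finset.univ.val.map f) (· ≤ ·),
      ← Multiset.sort_eq (Finset.univ.val.map g) (· ≤ ·)]
    exact congrArg _ h1
  · rintro ⟨σ, hσ⟩
    have h : Finset.univ.val.map f = Finset.univ.val.map g := by
      conv_rhs => rw [← Multiset.map_univ_val_equiv σ, Multiset.map_map]
      exact Multiset.map_congr rfl fun i _ => (hσ i).symm
    apply Subtype.ext
    simp only [sort, h]

end Sorting

/-! ### Edges, stars and row sums -/

section Edges

variable {n : ℕ}

/-- The edges of the complete graph on `Fin n`, as increasing pairs. -/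
abbrev Edge (n : ℕ) := {p : Fin n × Fin n // p.1 < p.2}

theorem mem_weightedAdjacency {x : Fin n × Fin n → ℝ} :
    x ∈ weightedAdjacency n ↔
      (∀ i j, x (i, j) = x (j, i)) ∧ (∀ i, x (i, i) = 0) ∧ ∀ i j, 0 ≤ x (i, j) := by
  refine and_congr ?_ Iff.rfl
  exact ⟨fun h i j => congrFun (congrFun h i) j, fun h => by ext i j; exact h i j⟩

theorem coe_smul_apply (σ : Equiv.Perm (Fin n)) (x : weightedAdjacency n) (i j : Fin n) :
    (σ • x).1 (i, j) = x.1 (σ⁻¹ i, σ⁻¹ j) :=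
  conj_apply σ (toMatrix x.1) i j

/-- The map that a permutation of the vertices induces on edges. -/
def edgeMap (σ : Equiv.Perm (Fin n)) (e : Edge n) : Edge n :=
  if h : σ e.1.1 < σ e.1.2 then ⟨(σ e.1.1, σ e.1.2), h⟩
  else ⟨(σ e.1.2, σ e.1.1), lt_of_le_of_ne (not_lt.1 h) (σ.injective.ne e.2.ne')⟩

theorem apply_edgeMap {x : Fin n × Fin n → ℝ} (hx : ∀ i j, x (i, j) = x (j, i))
    (σ : Equiv.Perm (Fin n)) (e : Edge n) : x (edgeMap σ e).1 = x (σ e.1.1, σ e.1.2) := by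
  unfold edgeMap
  split_ifs
  · rfl
  · exact hx _ _

theorem edgeMap_injective (σ : Equiv.Perm (Fin n)) : Function.Injective (edgeMap σ) := by
  rintro ⟨⟨a, b⟩, h1⟩ ⟨⟨c, d⟩, h2⟩ h
  unfold edgeMap at h
  dsimp only at h h1 h2
  split_ifs at h <;>
    simp only [Subtype.mk.injEq, Prod.mk.injEq, EmbeddingLike.apply_eq_iff_eq] at h ⊢
  · exact h
  · obtain ⟨rfl, rfl⟩ := h; exact absurd h1 h2.not_gt
  · obtain ⟨rfl, rfl⟩ := h; exact absurd h1 h2.not_gt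
  · exact h.symm

theorem smul_apply_edgeMap (σ : Equiv.Perm (Fin n)) (x : weightedAdjacency n) (e : Edge n) :
    (σ • x).1 (edgeMap σ e).1 = x.1 e.1 := by
  rw [apply_edgeMap (mem_weightedAdjacency.1 (σ • x).2).1, coe_smul_apply]
  simp

/-- The edges that contain a given vertex. -/
def star (i : Fin n) : Finset (Edge n) :=
  Finset.univ.filter fun e => e.1.1 = i ∨ e.1.2 = i

theorem sum_row_eq_sum_star {x : Fin n × Fin n → ℝ} (hx : ∀ i j, x (i, j) = x (j, i))
    (h0 : ∀ i, x (i, i) = 0) (i : Fin n) : ∑ j, x (i, j) = ∑ e ∈ star i, x e.1 := by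
  classical
  symm
  -- Each edge at `i` goes to its other endpoint. The index `j = i` comes from no edge, but its term
  -- is zero.
  refine Finset.sum_bij_ne_zero (fun e _ _ => if e.1.1 = i then e.1.2 else e.1.1)
    (fun _ _ _ => Finset.mem_univ _) ?_ ?_ ?_
  · rintro ⟨⟨a, b⟩, h1⟩ h2 - ⟨⟨c, d⟩, h3⟩ h4 - h
    simp only [star, Finset.mem_filter, Finset.mem_univ, true_and] at h1 h2 h3 h4 h
    simp only [Subtype.mk.injEq, Prod.mk.injEq]
    split_ifs at h <;> grind
  · intro j _ hj
    rcases lt_trichotomy i j with h | rfl | h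
    · exact ⟨⟨(i, j), h⟩, by simp [star], hj, by simp⟩
    · exact absurd (h0 i) hj
    · exact ⟨⟨(j, i), h⟩, by simp [star], by rwa [hx] at hj, by simp [h.ne]⟩
  · rintro ⟨⟨a, b⟩, h1⟩ h2 -
    simp only [star, Finset.mem_filter, Finset.mem_univ, true_and] at h2
    dsimp only
    split_ifs with h
    · rw [h]
    · rw [← h2.resolve_left h, hx]

theorem eq_of_mem_star {i j : Fin n} (hij : i ≠ j) {e : Edge n} (hi : e ∈ star i)
    (hj : e ∈ star j) : e.1 = (i, j) ∨ e.1 = (j, i) := by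
  obtain ⟨⟨a, b⟩, h⟩ := e
  simp only [star, Finset.mem_filter, Finset.mem_univ, true_and, Prod.mk.injEq] at *
  grind

end Edges

/-! ### Separation outside the singular set -/

section SingularSet

variable {n : ℕ}

/-- The weighted adjacency matrices with two different sets of edges of equal total weight. -/
def singularSet (n : ℕ) : Set (Fin n × Fin n → ℝ) :=
  {x | x ∈ weightedAdjacency n ∧
    ∃ S T : Finset (Edge n), S ≠ T ∧ ∑ e ∈ S, x e.1 = ∑ e ∈ T, x e.1}

theorem smul_mem_singularSet (σ : Equiv.Perm (Fin n)) (x : weightedAdjacency n)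
    (hx : x.1 ∈ singularSet n) : (σ • x).1 ∈ singularSet n := by
  obtain ⟨-, S, T, hST, h⟩ := hx
  refine ⟨(σ • x).2, S.map ⟨_, edgeMap_injective σ⟩, T.map ⟨_, edgeMap_injective σ⟩,
    (Finset.map_injective _).ne hST, ?_⟩
  simpa only [Finset.sum_map, Function.Embedding.coeFn_mk, smul_apply_edgeMap] using h

theorem graphInvariant_smul (σ : Equiv.Perm (Fin n)) (x : weightedAdjacency n) :
    graphInvariant (toMatrix (σ • x).1) = graphInvariant (toMatrix x.1) := by
  refine Prod.ext (sort_eq_sort_iff.2 ⟨σ⁻¹, fun i => ?_⟩) (Eq.symm (sort_eq_sort_iff.2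
    ⟨Equiv.ofBijective _ (Finite.injective_iff_bijective.1 (edgeMap_injective σ)),
      fun e => smul_apply_edgeMap σ x e⟩))
  simp only [Matrix.mulVec, dotProduct, Pi.one_apply, mul_one, toMatrix, Matrix.of_apply,
    coe_smul_apply]
  exact (Equiv.sum_comp σ⁻¹ fun j => x.1 (σ⁻¹ i, j)).symm

theorem mem_orbit_of_graphInvariant_eq {x y : weightedAdjacency n} (hx : x.1 ∉ singularSet n)
    (h : graphInvariant (toMatrix x.1) = graphInvariant (toMatrix y.1)) :
    y ∈ MulAction.orbit (Equiv.Perm (Fin n)) x := by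
  obtain ⟨hxs, hx0, -⟩ := mem_weightedAdjacency.1 x.2
  obtain ⟨hys, hy0, -⟩ := mem_weightedAdjacency.1 y.2
  obtain ⟨σ, hσ⟩ := sort_eq_sort_iff.1 (congrArg Prod.fst h.symm)
  obtain ⟨π, hπ⟩ := sort_eq_sort_iff.1 (congrArg Prod.snd h.symm)
  replace hπ : ∀ e : Edge n, x.1 (π e).1 = y.1 e.1 := hπ
  replace hσ : ∀ i, ∑ j, x.1 (σ i, j) = ∑ j, y.1 (i, j) := fun i => by
    simpa [Matrix.mulVec, dotProduct, toMatrix] using hσ i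
  -- Were these edge sets different, their equal `x`-weights would put `x` in the singular set.
  have hstar : ∀ i, (star i).map π.toEmbedding = star (σ i) := fun i => by
    by_contra hne
    refine hx ⟨x.2, _, _, hne, ?_⟩
    rw [Finset.sum_map, ← sum_row_eq_sum_star hxs hx0, hσ, sum_row_eq_sum_star hys hy0]
    exact Finset.sum_congr rfl fun e _ => hπ e
  have hedge : ∀ e : Edge n, y.1 e.1 = x.1 (σ e.1.1, σ e.1.2) := fun e => by
    have h1 : π e ∈ star (σ e.1.1) := by
      rw [← hstar]; exact Finset.mem_map_of_mem π.toEmbedding (by simp [star])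
    have h2 : π e ∈ star (σ e.1.2) := by
      rw [← hstar]; exact Finset.mem_map_of_mem π.toEmbedding (by simp [star])
    rw [← hπ]
    rcases eq_of_mem_star (σ.injective.ne e.2.ne) h1 h2 with h | h
    · rw [h]
    · rw [h, hxs]
  -- The inverse appears because the action by `τ` evaluates entries at `τ⁻¹`.
  refine ⟨σ⁻¹, Subtype.ext (funext fun ⟨i, j⟩ => ?_)⟩
  refine (coe_smul_apply σ⁻¹ x i j).trans ?_
  rw [inv_inv]
  rcases lt_trichotomy i j with h | rfl | h
  · exact (hedge ⟨(i, j), h⟩).symm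
  · rw [hx0, hy0]
  · rw [hxs, hys]; exact (hedge ⟨(j, i), h⟩).symm

theorem isSemialgebraic_weightedAdjacency (n : ℕ) : IsSemialgebraic (weightedAdjacency n) := by
  have h1 : IsSemialgebraic (⋂ i, ⋂ j, {x : Fin n × Fin n → ℝ |
      MvPolynomial.eval x (MvPolynomial.X (i, j) - MvPolynomial.X (j, i)) = 0}) :=
    .iInter fun i => .iInter fun j => .eq_zero _
  have h2 : IsSemialgebraic (⋂ i, {x : Fin n × Fin n → ℝ |
      MvPolynomial.eval x (MvPolynomial.X (i, i)) = 0}) :=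
    .iInter fun i => .eq_zero _
  have h3 : IsSemialgebraic (⋂ i, ⋂ j, {x : Fin n × Fin n → ℝ |
      0 ≤ MvPolynomial.eval x (MvPolynomial.X (i, j))}) :=
    .iInter fun i => .iInter fun j => .nonneg _
  convert h1.inter (h2.inter h3) using 1
  ext x
  simp [mem_weightedAdjacency, sub_eq_zero]

theorem isSemialgebraic_singularSet (n : ℕ) : IsSemialgebraic (singularSet n) := by
  have h : IsSemialgebraic (⋃ c : {c : Finset (Edge n) × Finset (Edge n) // c.1 ≠ c.2},
      {x : Fin n × Fin n → ℝ | MvPolynomial.eval x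
        (∑ e ∈ c.1.1, MvPolynomial.X e.1 - ∑ e ∈ c.1.2, MvPolynomial.X e.1) = 0}) :=
    .iUnion fun c => .eq_zero _
  convert (isSemialgebraic_weightedAdjacency n).inter h using 1
  ext x
  simp [singularSet, sub_eq_zero]

end SingularSet

/-! ### Stratification by faces and the dimension gap -/

section Faces

variable {n : ℕ}

/-- The symmetric matrices with zero diagonal that are supported on a set of edges. -/
def supportSpace (U : Finset (Edge n)) : Submodule ℝ (Fin n × Fin n → ℝ) where
  carrier := {x | (∀ i j, x (i, j) = x (j, i)) ∧ (∀ i, x (i, i) = 0) ∧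
    ∀ e : Edge n, e ∉ U → x e.1 = 0}
  zero_mem' := by simp
  add_mem' := by
    rintro x y ⟨h1, h2, h3⟩ ⟨h4, h5, h6⟩
    refine ⟨fun i j => ?_, fun i => ?_, fun e he => ?_⟩
    · simp only [Pi.add_apply, h1 i j, h4 i j]
    · simp only [Pi.add_apply, h2 i, h5 i, add_zero]
    · simp only [Pi.add_apply, h3 e he, h6 e he, add_zero]
  smul_mem' := by
    rintro c x ⟨h1, h2, h3⟩
    refine ⟨fun i j => ?_, fun i => ?_, fun e he => ?_⟩
    · simp only [Pi.smul_apply, h1 i j]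
    · simp only [Pi.smul_apply, h2 i, smul_zero]
    · simp only [Pi.smul_apply, h3 e he, smul_zero]

theorem mem_supportSpace {U : Finset (Edge n)} {x : Fin n × Fin n → ℝ} :
    x ∈ supportSpace U ↔ (∀ i j, x (i, j) = x (j, i)) ∧ (∀ i, x (i, i) = 0) ∧
      ∀ e : Edge n, e ∉ U → x e.1 = 0 := Iff.rfl

/-- The weighted adjacency matrices whose nonzero weights are on a given set of edges. -/
def face (U : Finset (Edge n)) : Set (Fin n × Fin n → ℝ) :=
  {x | x ∈ weightedAdjacency n ∧ ∀ e : Edge n, 0 < x e.1 ↔ e ∈ U}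

open Classical in
/-- The adjacency matrix of the graph with a given set of edges. -/
noncomputable def adjacency (U : Finset (Edge n)) : Fin n × Fin n → ℝ :=
  fun p => if ∃ e ∈ U, e.1 = p ∨ e.1 = p.swap then 1 else 0

theorem adjacency_apply_edge [DecidableEq (Edge n)] (U : Finset (Edge n)) (e : Edge n) :
    adjacency U e.1 = if e ∈ U then 1 else 0 := by
  unfold adjacency
  refine if_congr ⟨?_, fun h => ⟨e, h, Or.inl rfl⟩⟩ rfl rfl
  rintro ⟨f, hf, h | h⟩
  · rwa [← Subtype.ext h]
  · have h1 := f.2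
    rw [h] at h1
    exact absurd e.2 h1.not_gt

theorem adjacency_mem_face (U : Finset (Edge n)) : adjacency U ∈ face U := by
  classical
  refine ⟨mem_weightedAdjacency.2 ⟨fun i j => ?_, fun i => ?_, fun i j => ?_⟩, fun e => ?_⟩
  · unfold adjacency
    refine if_congr (exists_congr fun e => and_congr_right fun _ => ?_) rfl rfl
    rw [Prod.swap_prod_mk, Prod.swap_prod_mk, or_comm]
  · unfold adjacency
    refine if_neg ?_
    rintro ⟨e, -, h | h⟩ <;> exact absurd e.2 (by simp [h])
  · unfold adjacency
    split_ifs <;> norm_num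
  · rw [adjacency_apply_edge]
    split_ifs with h <;> simp [h]

theorem face_subset_supportSpace (U : Finset (Edge n)) : face U ⊆ supportSpace U := by
  rintro x ⟨hx, h⟩
  obtain ⟨h1, h2, h3⟩ := mem_weightedAdjacency.1 hx
  exact ⟨h1, h2, fun e he => le_antisymm (not_lt.1 fun h' => he ((h e).1 h')) (h3 _ _)⟩

theorem mem_face_of_mem_supportSpace {U : Finset (Edge n)} {x : Fin n × Fin n → ℝ}
    (hx : x ∈ supportSpace U) (h : ∀ e ∈ U, 0 < x e.1) : x ∈ face U := by
  obtain ⟨h1, h2, h3⟩ := mem_supportSpace.1 hx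
  have hpos : ∀ e : Edge n, 0 ≤ x e.1 := fun e => by
    by_cases he : e ∈ U
    · exact (h e he).le
    · exact (h3 e he).ge
  refine ⟨mem_weightedAdjacency.2 ⟨h1, h2, fun i j => ?_⟩, fun e => ⟨fun he => ?_, h e⟩⟩
  · rcases lt_trichotomy i j with h | rfl | h
    · exact hpos ⟨(i, j), h⟩
    · exact (h2 i).ge
    · rw [h1]; exact hpos ⟨(j, i), h⟩
  · by_contra h'
    exact he.ne' (h3 e h')

/-- A face is relatively open in its support space, so the identity serves as a chart. -/
theorem isSmoothSubmanifold_face (U : Finset (Edge n)) :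
    IsSmoothSubmanifold (Module.finrank ℝ (supportSpace U)) (face U) := by
  refine .of_isOpen_inter (supportSpace U) (O := ⋂ e ∈ U, {x | 0 < x e.1}) ?_ ?_ ?_
  · exact isOpen_biInter_finset fun e _ => isOpen_lt continuous_const (continuous_apply _)
  · exact fun x hx => Set.mem_iInter₂.2 fun e he => (hx.2 e).2 he
  · exact fun x hx => ⟨fun h => face_subset_supportSpace U h,
      fun h => mem_face_of_mem_supportSpace h (Set.mem_iInter₂.1 hx)⟩

theorem isSemialgebraic_face (U : Finset (Edge n)) : IsSemialgebraic (face U) := by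
  have h1 : IsSemialgebraic (⋂ e : {e // e ∈ U}, {x : Fin n × Fin n → ℝ |
      0 < MvPolynomial.eval x (MvPolynomial.X e.1.1)}) := .iInter fun _ => .pos _
  have h2 : IsSemialgebraic (⋂ e : {e // e ∉ U}, {x : Fin n × Fin n → ℝ |
      MvPolynomial.eval x (MvPolynomial.X e.1.1) = 0}) := .iInter fun _ => .eq_zero _
  convert (isSemialgebraic_weightedAdjacency n).inter (h1.inter h2) using 1
  ext x
  simp only [MvPolynomial.eval_X, Set.mem_inter_iff, Set.mem_iInter, Set.mem_ofPred_eq,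
    Subtype.forall (p := fun e => e ∈ U), Subtype.forall (p := fun e => e ∉ U)]
  constructor
  · exact fun h => ⟨h.1, fun e he => (h.2 e).2 he, (face_subset_supportSpace U h).2.2⟩
  · rintro ⟨hx, hp, hz⟩
    obtain ⟨h1, h2, -⟩ := mem_weightedAdjacency.1 hx
    exact mem_face_of_mem_supportSpace ⟨h1, h2, hz⟩ hp

/-- This strict monotonicity is all that the frontier condition needs; the dimensions themselves are
never computed. -/
theorem supportSpace_lt {U V : Finset (Edge n)} (h : V ⊂ U) : supportSpace V < supportSpace U := by
  have hVU := h.1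
  obtain ⟨e, heU, heV⟩ := Finset.exists_of_ssubset h
  refine SetLike.lt_iff_le_and_exists.2 ⟨fun x hx => ⟨hx.1, hx.2.1, fun e he =>
    hx.2.2 e fun h => he (hVU h)⟩, adjacency U, face_subset_supportSpace U (adjacency_mem_face U),
    fun hx => ?_⟩
  exact (((adjacency_mem_face U).2 e).2 heU).ne' (hx.2.2 e heV)

theorem closure_face_subset (U : Finset (Edge n)) : closure (face U) ⊆ supportSpace U :=
  closure_minimal (face_subset_supportSpace U) (Submodule.closed_of_finiteDimensional _)

theorem face_subset_closure_face {U V : Finset (Edge n)} (h : V ⊆ U) :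
    face V ⊆ closure (face U) := by
  intro y hy
  obtain ⟨hy1, hy2, hy3⟩ := face_subset_supportSpace V hy
  -- Adding a small positive multiple of the adjacency matrix of `U` makes all weights on `U`
  -- positive.
  have hlim : Filter.Tendsto (fun t : ℝ => y + t • adjacency U) (nhdsWithin 0 (Set.Ioi 0))
      (nhds y) := by
    have : Continuous fun t : ℝ => y + t • adjacency U := by fun_prop
    simpa using (this.tendsto 0).mono_left nhdsWithin_le_nhds
  refine mem_closure_of_tendsto hlim ?_
  filter_upwards [self_mem_nhdsWithin] with t (ht : 0 < t)
  have hyU : y ∈ supportSpace U := ⟨hy1, hy2, fun e he => hy3 e fun h' => he (h h')⟩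
  refine mem_face_of_mem_supportSpace ((supportSpace U).add_mem hyU ((supportSpace U).smul_mem t
    (face_subset_supportSpace U (adjacency_mem_face U)))) fun e he => ?_
  have h1 : 0 ≤ y e.1 := (mem_weightedAdjacency.1 hy.1).2.2 _ _
  have h2 := mul_pos ht (((adjacency_mem_face U).2 e).2 he)
  exact add_pos_of_nonneg_of_pos h1 h2

theorem isStratification_face (n : ℕ) :
    IsStratification (weightedAdjacency n)
      (fun k => face ((Fintype.equivFin (Finset (Edge n))).symm k))
      (fun k => Module.finrank ℝ (supportSpace ((Fintype.equivFin (Finset (Edge n))).symm k))) where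
  iUnion_eq := by
    classical
    refine Set.Subset.antisymm (Set.iUnion_subset fun k x hx => hx.1) fun x hx => ?_
    refine Set.mem_iUnion.2 ⟨Fintype.equivFin _ (Finset.univ.filter fun e : Edge n => 0 < x e.1), ?_⟩
    rw [Equiv.symm_apply_apply]
    exact ⟨hx, fun e => by simp⟩
  disjoint k l hkl := by
    refine Set.disjoint_left.2 fun x hx hy => hkl ?_
    refine (Fintype.equivFin (Finset (Edge n))).symm.injective (Finset.ext fun e => ?_)
    exact (hx.2 e).symm.trans (hy.2 e)
  nonempty k := ⟨_, adjacency_mem_face _⟩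
  semialgebraic k := isSemialgebraic_face _
  manifold k := isSmoothSubmanifold_face _
  frontier k l hkl := by
    rintro ⟨x, hx, hy⟩
    have hx' := closure_face_subset _ hx
    -- The point `x` vanishes off the edges of the closed-up face and is positive on those of the
    -- other.
    have hsub : (Fintype.equivFin (Finset (Edge n))).symm l ⊆
        (Fintype.equivFin (Finset (Edge n))).symm k := fun e he => by
      by_contra h
      exact ((hy.2 e).2 he).ne' (hx'.2.2 e h)
    refine ⟨face_subset_closure_face hsub, Submodule.finrank_lt_finrank_of_lt (supportSpace_lt ?_)⟩
    exact lt_of_le_of_ne hsub fun h => hkl ((Equiv.injective _ h).symm)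

/-- The symmetric matrices with zero diagonal for which two sets of edges have equal total weight. -/
def balancedSpace (S T : Finset (Edge n)) : Submodule ℝ (Fin n × Fin n → ℝ) :=
  supportSpace Finset.univ ⊓ LinearMap.ker
    (∑ e ∈ S, LinearMap.proj (R := ℝ) e.1 - ∑ e ∈ T, LinearMap.proj (R := ℝ) e.1 :
      (Fin n × Fin n → ℝ) →ₗ[ℝ] ℝ)

theorem mem_balancedSpace {S T : Finset (Edge n)} {x : Fin n × Fin n → ℝ} :
    x ∈ balancedSpace S T ↔
      x ∈ supportSpace Finset.univ ∧ ∑ e ∈ S, x e.1 = ∑ e ∈ T, x e.1 := by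
  simp [balancedSpace, sub_eq_zero]

theorem balancedSpace_lt {S T : Finset (Edge n)} (h : S ≠ T) :
    balancedSpace S T < supportSpace Finset.univ := by
  classical
  refine lt_of_le_of_ne inf_le_left fun heq => h (Finset.ext fun e => ?_)
  -- If the two spaces agreed, a single edge of weight one would be balanced, so it would lie in
  -- both sets or in neither.
  have hmem : adjacency {e} ∈ balancedSpace S T := by
    rw [heq]
    obtain ⟨h1, h2, -⟩ := face_subset_supportSpace _ (adjacency_mem_face {e})
    exact ⟨h1, h2, fun f hf => absurd (Finset.mem_univ f) hf⟩
  have hsum := (mem_balancedSpace.1 hmem).2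
  simp only [adjacency_apply_edge, Finset.mem_singleton, Finset.sum_ite_eq'] at hsum
  by_cases h1 : e ∈ S <;> by_cases h2 : e ∈ T <;> simp [h1, h2] at hsum ⊢

theorem dim_singularSet_lt (hn : 2 ≤ n) : dim (singularSet n) < dim (weightedAdjacency n) := by
  -- Two vertices give at least one edge. Positivity is needed because the truncated subtraction
  -- below must strictly decrease the rank.
  have hpos : 0 < Module.finrank ℝ (supportSpace (Finset.univ : Finset (Edge n))) := by
    have e : Edge n := ⟨(⟨0, by omega⟩, ⟨1, by omega⟩), by simp⟩
    exact (Nat.zero_le _).trans_lt (Submodule.finrank_lt_finrank_of_lt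
      (balancedSpace_lt (Finset.singleton_ne_empty e)))
  have h1 : dim (singularSet n) ≤
      ((Module.finrank ℝ (supportSpace (Finset.univ : Finset (Edge n))) - 1 : ℕ) : ℕ∞) := by
    refine dim_le_of_covered
      (κ := {c : Finset (Edge n) × Finset (Edge n) // c.1 ≠ c.2})
      (fun c => balancedSpace c.1.1 c.1.2) ?_ fun c =>
        Nat.le_sub_one_of_lt (Submodule.finrank_lt_finrank_of_lt (balancedSpace_lt c.2))
    rintro x ⟨hx, S, T, hST, h⟩
    obtain ⟨h1, h2, -⟩ := mem_weightedAdjacency.1 hx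
    exact ⟨⟨(S, T), hST⟩, mem_balancedSpace.2
      ⟨⟨h1, h2, fun f hf => absurd (Finset.mem_univ f) hf⟩, h⟩⟩
  -- The open face, with all weights positive, is the stratum of top dimension.
  have h2 := (isStratification_face n).le_dim (Fintype.equivFin (Finset (Edge n)) Finset.univ)
  rw [Equiv.symm_apply_apply] at h2
  refine h1.trans_lt (lt_of_lt_of_le ?_ h2)
  exact_mod_cast Nat.sub_one_lt hpos.ne'

end Faces

end GenericGraph

theorem mainTheorem11 (n : ℕ) (hn : 2 ≤ n) :
    (∀ (σ : Equiv.Perm (Fin n)) (A : GenericGraph.weightedAdjacency n),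
      GenericGraph.graphInvariant (GenericGraph.toMatrix (σ • A : GenericGraph.weightedAdjacency n).1) =
        GenericGraph.graphInvariant (GenericGraph.toMatrix A.1)) ∧
    ∃ N : Set (Fin n × Fin n → ℝ),
      GenericGraph.IsGenericallySeparating (Equiv.Perm (Fin n)) (GenericGraph.weightedAdjacency n)
        (fun A => GenericGraph.graphInvariant (GenericGraph.toMatrix A.1)) N :=
  ⟨GenericGraph.graphInvariant_smul, GenericGraph.singularSet n,
    { semialgebraic_domain := GenericGraph.isSemialgebraic_weightedAdjacency n
      invariant := GenericGraph.graphInvariant_smul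
      subset := fun _ hx => hx.1
      semialgebraic := GenericGraph.isSemialgebraic_singularSet n
      stable := GenericGraph.smul_mem_singularSet
      dim_lt := GenericGraph.dim_singularSet_lt hn
      separating := fun _ hx _ h => GenericGraph.mem_orbit_of_graphInvariant_eq hx h }⟩
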